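/- Setting. Let $K\ge 1$ and let $F^{(1)},\dots,F^{(K)}$ be probability distributions on $\mathbb R$ (the arms), identified with their distribution functions. Let $\mathcal D^{\Delta}=\{\sum_{i=1}^K p_iF^{(i)} : p_i\ge 0,\ \sum_i p_i=1\}$ be the set of their mixtures, and let $\hat{\mathcal D}$ be the set of the empirical distributions of all finite sequences $x_1,\dots,x_t\in\mathbb R$, $t\ge 1$. Let $(X^{(i)}_s)_{s\ge 1}$, $1\le i\le K$, be mutually independent random variables with $X^{(i)}_s\sim F^{(i)}$, and let $\hat F^{(i)}_t$ be the empirical distribution of $X^{(i)}_1,\dots,X^{(i)}_t$. For a linear combination $f$ of distribution functions with finite first moment put $$\|f\|=\max\Big\{\|f\|_\infty,\ \Big|\int_{-\infty}^0 x\,df\Big|,\ \Big|\int_0^\infty x\,df\Big|\Big\}.$$ Let $\alpha\in(0,1)$ and $\mathrm{VaR}_\alpha(F)=\inf\{y\in\mathbb R: F(y)\ge\alpha\}$. A functional $R$ is called strongly stable with constants $b>0$, $q\ge 1$ if 1. $|R(F)-R(G)|\le b\,\big(\|F-G\|+\|F-G\|^q\big)$ for all $F\in\mathcal D^\Delta$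 and $G\in\mathcal D^\Delta\cup\hat{\mathcal D}$; 2. there is a constant $a>0$, depending only on the distributions $F^{(i)}$, such that $\mathbb P\big(\|\hat F^{(i)}_t-F^{(i)}\|\ge x\big)\le 2\exp(-a t x^2)$ for all $1\le i\le K$, $x>0$ and $t\ge 1$. Proposition (VaR strong stability). Suppose that - (C2) every $F^{(i)}$ is sub-Gaussian, i.e. there is $\sigma_i\ge 0$ such that, for $X\sim F^{(i)}$, $\mathbb E\,e^{\lambda(X-\mathbb EX)}\le e^{\sigma_i^2\lambda^2/2}$ for all $\lambda\in\mathbb R$; and - (C4) $b_\alpha>0$ and $M_\alpha>0$ are constants with $M_\alpha\ge\max_{F,G\in\mathcal D^\Delta}\|F-G\|$ such that, for every $F\in\mathcal D^\Delta$, $$\big|F\big(\mathrm{VaR}_\alpha(F)+b_\alpha y\big)-\alpha\big|\ge |y|\qquad\text{for all } y\in[-M_\alpha,M_\alpha].$$ Then the maximum $c^*=\max_{F\in\mathcal D^\Delta}\|F\|$ exists, and $\mathrm{VaR}_\alpha$ is strongly stable with $q=1$ and $$b=\max\Big\{b_\alpha,\ \frac{M_\alpha+2c^*}{\min\{\alpha,1-\alpha\}\,M_\alpha}\Big\}.$$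 -/

import Mathlib

open MeasureTheory ProbabilityTheory Set
open scoped ENNReal NNReal

universe u

noncomputable section

namespace RiskBandit

/-- The signed measure `F - G`, standing for the difference of the two distributions. -/
def diff (F G : ProbabilityMeasure ℝ) : SignedMeasure ℝ :=
  (F : Measure ℝ).toSignedMeasure - (G : Measure ℝ).toSignedMeasure

/-- The norm `max {‖f‖_∞, |∫_{-∞}^0 x df|, |∫_0^∞ x df|}`. The function `f` of bounded variation is
represented by its Lebesgue-Stieltjes signed measure `s`, so `f y = s (Iic y)`. -/
def tailNorm (s : SignedMeasure ℝ) : ℝ :=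
  max (⨆ y : ℝ, |s (Iic y)|)
    (max |∫ᵛ x in Iic (0 : ℝ), x ∂<•s| |∫ᵛ x in Ici (0 : ℝ), x ∂<•s|)

/-- Value at Risk at level `α`: `inf {y | F(y) ≥ α}`, where `F(y)` is the distribution function. -/
def VaR (α : ℝ) (F : ProbabilityMeasure ℝ) : ℝ :=
  sInf {y : ℝ | α ≤ cdf (F : Measure ℝ) y}

/-- The mixture `∑ i, p i • F i`. -/
def mixture {K : ℕ} (F : Fin K → ProbabilityMeasure ℝ) (p : stdSimplex ℝ (Fin K)) :
    ProbabilityMeasure ℝ :=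
  ⟨∑ i, ENNReal.ofReal (p.1 i) • (F i : Measure ℝ), ⟨by
    simp only [Measure.coe_finsetSum, Finset.sum_apply, Measure.smul_apply, measure_univ,
      smul_eq_mul, mul_one]
    rw [← ENNReal.ofReal_sum_of_nonneg (fun i _ => p.2.1 i), p.2.2, ENNReal.ofReal_one]⟩⟩

/-- The set of all convex combinations of the arm distributions. -/
def mixtures {K : ℕ} (F : Fin K → ProbabilityMeasure ℝ) : Set (ProbabilityMeasure ℝ) :=
  range (mixture F)

/-- The empirical distribution of `x_1, …, x_t` (`t ≥ 1`). -/
def empirical {t : ℕ} [NeZero t] (x : Fin t → ℝ) : ProbabilityMeasure ℝ :=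
  ⟨(t : ℝ≥0∞)⁻¹ • ∑ s, Measure.dirac (x s), ⟨by
    simp only [Measure.smul_apply, Measure.coe_finsetSum, Finset.sum_apply, measure_univ,
      Finset.sum_const, Finset.card_univ, Fintype.card_fin, nsmul_eq_mul, mul_one, smul_eq_mul]
    exact ENNReal.inv_mul_cancel (Nat.cast_ne_zero.mpr (NeZero.ne t))
      (ENNReal.natCast_ne_top t)⟩⟩

/-- The set of empirical distributions of all finite nonempty real sequences. -/
def empiricals : Set (ProbabilityMeasure ℝ) :=
  {G | ∃ (t : ℕ) (_ : NeZero t) (x : Fin t → ℝ), G = empirical x}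

/-- `X i s` is the reward of the `(s+1)`-st pull of arm `i`: it has distribution `F i`, and all the
rewards are mutually independent. -/
structure IsRewardArray {K : ℕ} {Ω : Type u} [MeasurableSpace Ω]
    (F : Fin K → ProbabilityMeasure ℝ) (P : Measure Ω) (X : Fin K → ℕ → Ω → ℝ) : Prop where
  measurable : ∀ i s, Measurable (X i s)
  law : ∀ i s, P.map (X i s) = (F i : Measure ℝ)
  indep : iIndepFun (fun (j : Fin K × ℕ) => X j.1 j.2) P

/-- Strong stability of `R`, with respect to the norm `N` and the arm distributions `F`, with the
constants `b` and `q`. The constant `a` may not depend on the probability space carrying the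
rewards. -/
structure StronglyStableWith {K : ℕ} (N : SignedMeasure ℝ → ℝ)
    (F : Fin K → ProbabilityMeasure ℝ) (R : ProbabilityMeasure ℝ → ℝ) (b q : ℝ) : Prop where
  b_pos : 0 < b
  one_le_q : 1 ≤ q
  modulus : ∀ G ∈ mixtures F, ∀ H ∈ mixtures F ∪ empiricals,
    |R G - R H| ≤ b * (N (diff G H) + N (diff G H) ^ q)
  concentration : ∃ a : ℝ, 0 < a ∧
    ∀ (Ω : Type u) [MeasurableSpace Ω] (P : Measure Ω) [IsProbabilityMeasure P]
      (X : Fin K → ℕ → Ω → ℝ), IsRewardArray F P X →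
      ∀ (i : Fin K) (t : ℕ) [NeZero t] (x : ℝ), 0 < x →
        P.real {ω | x ≤ N (diff (empirical fun s : Fin t => X i s ω) (F i))}
          ≤ 2 * Real.exp (-a * t * x ^ 2)

/-- A sub-Gaussian distribution: the centred variable has moment generating function at most
`exp (c t² / 2)` for some `c`. -/
def IsSubGaussian (F : ProbabilityMeasure ℝ) : Prop :=
  ∃ c : ℝ≥0, HasSubgaussianMGF (fun x : ℝ => x - ∫ y, y ∂(F : Measure ℝ)) c (F : Measure ℝ)

/-- The quantile-growth condition at level `α` with constants `bα` and `Mα`, where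
`Mα ≥ max ‖G - H‖` over pairs of mixtures of the arms. -/
structure QuantileGrowth {K : ℕ} (N : SignedMeasure ℝ → ℝ)
    (F : Fin K → ProbabilityMeasure ℝ) (α bα Mα : ℝ) : Prop where
  b_pos : 0 < bα
  M_pos : 0 < Mα
  norm_le : ∀ G ∈ mixtures F, ∀ H ∈ mixtures F, N (diff G H) ≤ Mα
  growth : ∀ G ∈ mixtures F, ∀ y ∈ Icc (-Mα) Mα,
    |y| ≤ |cdf (G : Measure ℝ) (VaR α G + bα * y) - α|

end RiskBandit

end

/-! Write `N` for the norm of `G - H`, with `G` a mixture. If `N < Mα`, the growth of `G` at its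
quantile beats a uniform perturbation of size `N`, so the quantiles differ by at most `bα * N`
(`abs_VaR_sub_le_of_growth`). If `N ≥ Mα`, no local information is left. A Markov-type bound
(`abs_VaR_mul_le`) controls each quantile by the partial first moments, which are at most `c` for
`G` and `c + N` for `H`; since `N ≥ Mα`, the constant `2 * c` is absorbed into a multiple of `N`.
The maximum `c` exists because the norm of a mixture is continuous in the weights, which range over
a compact simplex.

For the concentration, the partial first moments are means of the 1-Lipschitz functions `min x 0`
and `max x 0`. Symmetrisation shows that these stay sub-Gaussian
(`hasSubgaussianMGF_of_abs_sub_le`), and Hoeffding's inequality applies. The uniform distance needs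
a DKW inequality. Along increasing sets `B` the sum of the normalised indicators `(1_B - μ B) / (1 -
μ B)` over the sample is a martingale, so Doob's maximal inequality for its exponential reduces the
supremum to a single set. While `μ B ≤ 1/2` the summands lie in `[-1, 1]` and Hoeffding's lemma
bounds the last term; the other half-lines are handled through their complements. -/

namespace RiskBandit

/-! ### The components of the norm. -/

section TailNorm

variable (G H : ProbabilityMeasure ℝ)

lemma toSignedMeasure_Iic (y : ℝ) :
    (G : Measure ℝ).toSignedMeasure (Iic y) = cdf (G : Measure ℝ) y := by
  rw [Measure.toSignedMeasure_apply_measurable measurableSet_Iic, cdf_eq_real]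

lemma diff_Iic (y : ℝ) :
    diff G H (Iic y) = cdf (G : Measure ℝ) y - cdf (H : Measure ℝ) y := by
  rw [diff, FunLike.coe_sub, Pi.sub_apply, toSignedMeasure_Iic, toSignedMeasure_Iic]

lemma abs_cdf_sub_le_one (y : ℝ) :
    |cdf (G : Measure ℝ) y - cdf (H : Measure ℝ) y| ≤ 1 := by
  rw [abs_le]
  constructor <;> linarith [cdf_nonneg (G : Measure ℝ) y, cdf_nonneg (H : Measure ℝ) y,
    cdf_le_one (G : Measure ℝ) y, cdf_le_one (H : Measure ℝ) y]

/-- Without a bound the real supremum in `tailNorm` would take the default value `0`. -/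
lemma bddAbove_abs_diff_Iic : BddAbove (range fun y : ℝ => |diff G H (Iic y)|) := by
  refine ⟨1, ?_⟩
  rintro _ ⟨y, rfl⟩
  simpa only [diff_Iic] using abs_cdf_sub_le_one G H y

lemma abs_cdf_sub_le_tailNorm (y : ℝ) :
    |cdf (G : Measure ℝ) y - cdf (H : Measure ℝ) y| ≤ tailNorm (diff G H) := by
  rw [← diff_Iic]
  exact (le_ciSup (bddAbove_abs_diff_Iic G H) y).trans (le_max_left _ _)

lemma tailNorm_diff_nonneg : 0 ≤ tailNorm (diff G H) :=
  (abs_nonneg _).trans (abs_cdf_sub_le_tailNorm G H 0)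

variable {G H}

lemma setIntegral_diff {s : Set ℝ} (hs : MeasurableSet s)
    (hG : Integrable (fun x : ℝ => x) (G : Measure ℝ))
    (hH : Integrable (fun x : ℝ => x) (H : Measure ℝ)) :
    ∫ᵛ x in s, x ∂<•(diff G H) =
      ∫ x in s, x ∂(G : Measure ℝ) - ∫ x in s, x ∂(H : Measure ℝ) := by
  rw [diff, VectorMeasure.restrict_sub, VectorMeasure.integral_sub_vectorMeasure,
    VectorMeasure.setIntegral_toSignedMeasure hs, VectorMeasure.setIntegral_toSignedMeasure hs]
  · rw [VectorMeasure.Integrable, VectorMeasure.restrict_toSignedMeasure hs,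
      Measure.variation_toSignedMeasure]
    exact hG.restrict
  · rw [VectorMeasure.Integrable, VectorMeasure.restrict_toSignedMeasure hs,
      Measure.variation_toSignedMeasure]
    exact hH.restrict

lemma abs_setIntegral_Iic_sub_le_tailNorm
    (hG : Integrable (fun x : ℝ => x) (G : Measure ℝ))
    (hH : Integrable (fun x : ℝ => x) (H : Measure ℝ)) :
    |∫ x in Iic 0, x ∂(G : Measure ℝ) - ∫ x in Iic 0, x ∂(H : Measure ℝ)|
      ≤ tailNorm (diff G H) := by
  rw [← setIntegral_diff measurableSet_Iic hG hH]
  exact (le_max_left _ _).trans (le_max_right _ _)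

lemma abs_setIntegral_Ici_sub_le_tailNorm
    (hG : Integrable (fun x : ℝ => x) (G : Measure ℝ))
    (hH : Integrable (fun x : ℝ => x) (H : Measure ℝ)) :
    |∫ x in Ici 0, x ∂(G : Measure ℝ) - ∫ x in Ici 0, x ∂(H : Measure ℝ)|
      ≤ tailNorm (diff G H) := by
  rw [← setIntegral_diff measurableSet_Ici hG hH]
  exact (le_max_right _ _).trans (le_max_right _ _)

/-- If the norm of `G - H` is large, then so is one of its three components, and the first of them
may be evaluated at a rational number. -/
lemma exists_rat_or_of_le_tailNorm
    (hG : Integrable (fun x : ℝ => x) (G : Measure ℝ))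
    (hH : Integrable (fun x : ℝ => x) (H : Measure ℝ)) {x : ℝ} (hx : 0 < x)
    (h : x ≤ tailNorm (diff G H)) :
    (∃ q : ℚ, x / 2 < |cdf (G : Measure ℝ) q - cdf (H : Measure ℝ) q|) ∨
      x ≤ |∫ x in Iic 0, x ∂(G : Measure ℝ) - ∫ x in Iic 0, x ∂(H : Measure ℝ)| ∨
      x ≤ |∫ x in Ici 0, x ∂(G : Measure ℝ) - ∫ x in Ici 0, x ∂(H : Measure ℝ)| := by
  rw [← setIntegral_diff measurableSet_Iic hG hH, ← setIntegral_diff measurableSet_Ici hG hH]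
  rw [tailNorm, le_max_iff, le_max_iff] at h
  refine h.imp_left fun h => ?_
  -- The supremum need not be attained; `x / 2` gives a strict inequality at some `y`, which right
  -- continuity carries to a rational on the right of `y`.
  obtain ⟨y, hy⟩ := exists_lt_of_lt_ciSup ((half_lt_self hx).trans_le h)
  rw [diff_Iic] at hy
  have hcont : ContinuousWithinAt
      (fun z => |cdf (G : Measure ℝ) z - cdf (H : Measure ℝ) z|) (Ici y) y :=
    (((cdf (G : Measure ℝ)).right_continuous y).sub
      ((cdf (H : Measure ℝ)).right_continuous y)).abs
  have hev := hcont.eventually_const_lt hy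
  obtain ⟨u, hu, hsub⟩ := mem_nhdsGE_iff_exists_Ico_subset.1 hev
  obtain ⟨q, hq1, hq2⟩ := exists_rat_btwn (mem_Ioi.1 hu)
  exact ⟨q, hsub ⟨hq1.le, hq2⟩⟩

lemma iSup_abs_toSignedMeasure_Iic (G : ProbabilityMeasure ℝ) :
    ⨆ y : ℝ, |(G : Measure ℝ).toSignedMeasure (Iic y)| = 1 := by
  simp_rw [toSignedMeasure_Iic, abs_of_nonneg (cdf_nonneg (G : Measure ℝ) _)]
  have hb : BddAbove (range (cdf (G : Measure ℝ))) := by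
    refine ⟨1, ?_⟩
    rintro _ ⟨y, rfl⟩
    exact cdf_le_one _ y
  exact (tendsto_nhds_unique (tendsto_cdf_atTop (G : Measure ℝ))
    (tendsto_atTop_ciSup (monotone_cdf _) hb)).symm

/-- The uniform part is always `1`, so only the two partial moments vary with the distribution. -/
lemma tailNorm_toSignedMeasure (G : ProbabilityMeasure ℝ) :
    tailNorm (G : Measure ℝ).toSignedMeasure =
      max 1 (max |∫ x in Iic 0, x ∂(G : Measure ℝ)| |∫ x in Ici 0, x ∂(G : Measure ℝ)|) := by
  rw [tailNorm, iSup_abs_toSignedMeasure_Iic,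
    VectorMeasure.setIntegral_toSignedMeasure measurableSet_Iic,
    VectorMeasure.setIntegral_toSignedMeasure measurableSet_Ici]

end TailNorm

/-! ### Continuity of the quantile. -/

section ValueAtRisk

variable {α : ℝ} {G H : ProbabilityMeasure ℝ}

/-- Right continuity puts the infimum in the set; `0 < α < 1` makes the set bounded below and
nonempty, so `sInf` is a genuine infimum. -/
lemma VaR_le_iff (hα : α ∈ Ioo (0 : ℝ) 1) {y : ℝ} :
    VaR α G ≤ y ↔ α ≤ cdf (G : Measure ℝ) y := by
  have hbdd : BddBelow {y : ℝ | α ≤ cdf (G : Measure ℝ) y} := by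
    obtain ⟨z, hz⟩ := ((tendsto_cdf_atBot (G : Measure ℝ)).eventually_lt_const hα.1).exists
    refine ⟨z, fun w hw => ?_⟩
    by_contra! h
    exact absurd (hw.trans (monotone_cdf _ h.le)) (not_le.2 hz)
  have hne : {y : ℝ | α ≤ cdf (G : Measure ℝ) y}.Nonempty := by
    obtain ⟨z, hz⟩ := ((tendsto_cdf_atTop (G : Measure ℝ)).eventually_const_lt hα.2).exists
    exact ⟨z, hz.le⟩
  refine ⟨fun h => ?_, fun h => csInf_le hbdd h⟩
  have hcont := ((cdf (G : Measure ℝ)).right_continuous y).mono Ioi_subset_Ici_self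
  refine ge_of_tendsto hcont.tendsto ?_
  filter_upwards [self_mem_nhdsWithin] with z hz
  obtain ⟨s, hs, hsz⟩ := exists_lt_of_csInf_lt hne (h.trans_lt hz)
  exact le_trans hs (monotone_cdf _ hsz.le)

lemma lt_VaR_iff (hα : α ∈ Ioo (0 : ℝ) 1) {y : ℝ} :
    y < VaR α G ↔ cdf (G : Measure ℝ) y < α := by
  rw [← not_le, VaR_le_iff hα, not_le]

/-- Near its quantile, a distribution that grows at least linearly there pins down the quantile of
every distribution that is uniformly close to it. -/
lemma abs_VaR_sub_le_of_growth (hα : α ∈ Ioo (0 : ℝ) 1) {b M N : ℝ} (hb : 0 < b)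
    (hgrowth : ∀ y ∈ Icc (-M) M, |y| ≤ |cdf (G : Measure ℝ) (VaR α G + b * y) - α|)
    (hN : 0 ≤ N) (hNM : N < M)
    (hclose : ∀ y, |cdf (G : Measure ℝ) y - cdf (H : Measure ℝ) y| ≤ N) :
    |VaR α G - VaR α H| ≤ b * N := by
  have hup : ∀ y, 0 ≤ y → y ≤ M → α + y ≤ cdf (G : Measure ℝ) (VaR α G + b * y) := by
    intro y h0 hM
    have h := hgrowth y ⟨by linarith, hM⟩
    -- The position relative to the quantile fixes the sign inside the absolute value of the growth
    -- bound.
    have h1 : α ≤ cdf (G : Measure ℝ) (VaR α G + b * y) :=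
      (VaR_le_iff hα).1 (le_add_of_nonneg_right (mul_nonneg hb.le h0))
    rw [abs_of_nonneg h0, abs_of_nonneg (by linarith)] at h
    linarith
  have hdown : ∀ y, 0 < y → y ≤ M → cdf (G : Measure ℝ) (VaR α G - b * y) ≤ α - y := by
    intro y h0 hM
    have h := hgrowth (-y) ⟨by linarith, by linarith⟩
    have h1 : cdf (G : Measure ℝ) (VaR α G - b * y) < α :=
      (lt_VaR_iff hα).1 (sub_lt_self _ (mul_pos hb h0))
    rw [mul_neg, ← sub_eq_add_neg, abs_neg, abs_of_pos h0, abs_of_neg (by linarith)] at h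
    linarith
  rw [abs_le]
  constructor
  · have h : VaR α H ≤ VaR α G + b * N := by
      rw [VaR_le_iff hα]
      have h1 := hup N hN hNM.le
      have h2 := (abs_le.1 (hclose (VaR α G + b * N))).2
      linarith
    linarith
  · have h : VaR α G - b * N ≤ VaR α H := by
      refine le_of_forall_lt fun z hz => ?_
      rw [lt_VaR_iff hα]
      -- Since `z < VaR α G - b * N` and `N < M`, there is room for `y > N`; the slack makes the cdf
      -- of `H` at `z` strictly less than `α`.
      obtain ⟨y, hy1, hy2⟩ := exists_between
        (lt_min hNM (show N < (VaR α G - z) / b by rw [lt_div_iff₀ hb]; linarith))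
      rw [lt_min_iff, lt_div_iff₀ hb] at hy2
      have h1 := hdown y (hN.trans_lt hy1) hy2.1.le
      have h2 := (abs_le.1 (hclose z)).1
      have h3 : cdf (G : Measure ℝ) z ≤ cdf (G : Measure ℝ) (VaR α G - b * y) :=
        monotone_cdf _ (by linarith)
      linarith
    linarith

/-- The quantile is controlled by the partial first moments. -/
lemma abs_VaR_mul_le (hα : α ∈ Ioo (0 : ℝ) 1)
    (hG : Integrable (fun x : ℝ => x) (G : Measure ℝ)) :
    |VaR α G| * min α (1 - α) ≤
      max |∫ x in Iic 0, x ∂(G : Measure ℝ)| |∫ x in Ici 0, x ∂(G : Measure ℝ)| := by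
  have hα0 := hα.1
  have hα1 := hα.2
  rcases lt_or_ge 0 (VaR α G) with h | h
  · rw [abs_of_pos h]
    -- The mass above `z` is at least `1 - α` only for `z` strictly below the quantile, so the bound
    -- is reached by letting `z` increase to it.
    have key : ∀ z, 0 < z → z < VaR α G → z * (1 - α) ≤ ∫ x in Ici 0, x ∂(G : Measure ℝ) := by
      intro z hz0 hz
      have h1 : 1 - α ≤ (G : Measure ℝ).real (Ioi z) := by
        have h2 := (lt_VaR_iff hα).1 hz
        rw [cdf_eq_real] at h2
        rw [← compl_Iic, probReal_compl_eq_one_sub measurableSet_Iic]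
        linarith
      calc z * (1 - α) ≤ z * (G : Measure ℝ).real (Ioi z) := by gcongr
        _ = ∫ x in Ioi z, z ∂(G : Measure ℝ) := by
          rw [setIntegral_const, smul_eq_mul, mul_comm]
        _ ≤ ∫ x in Ioi z, x ∂(G : Measure ℝ) :=
          setIntegral_mono_on (integrable_const z).integrableOn hG.integrableOn measurableSet_Ioi
            fun x hx => le_of_lt hx
        _ ≤ ∫ x in Ici 0, x ∂(G : Measure ℝ) :=
          setIntegral_mono_set hG.integrableOn
            ((ae_restrict_mem measurableSet_Ici).mono fun x hx => hx)
            (LE.le.eventuallyLE fun x hx => le_of_lt (hz0.trans hx))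
    have h2 : VaR α G * (1 - α) ≤ ∫ x in Ici 0, x ∂(G : Measure ℝ) := by
      rw [← le_div_iff₀ (by linarith)]
      refine le_of_forall_lt_imp_le_of_dense fun z hz => ?_
      rw [le_div_iff₀ (by linarith)]
      rcases le_or_gt z 0 with hz0 | hz0
      · exact (mul_nonpos_of_nonpos_of_nonneg hz0 (by linarith)).trans
          (setIntegral_nonneg measurableSet_Ici fun x hx => hx)
      · exact key z hz0 hz
    calc VaR α G * min α (1 - α) ≤ VaR α G * (1 - α) := by gcongr; exact min_le_right _ _
      _ ≤ |∫ x in Ici 0, x ∂(G : Measure ℝ)| := h2.trans (le_abs_self _)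
      _ ≤ _ := le_max_right _ _
  · rw [abs_of_nonpos h]
    have h1 : α ≤ (G : Measure ℝ).real (Iic (VaR α G)) := by
      rw [← cdf_eq_real]
      exact (VaR_le_iff hα).1 le_rfl
    have hneg : Integrable (fun x : ℝ => -x) (G : Measure ℝ) := hG.neg
    calc -VaR α G * min α (1 - α)
        ≤ -VaR α G * (G : Measure ℝ).real (Iic (VaR α G)) := by
          have := (min_le_left α (1 - α)).trans h1
          have : 0 ≤ -VaR α G := by linarith
          gcongr
      _ = ∫ x in Iic (VaR α G), -VaR α G ∂(G : Measure ℝ) := by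
          rw [setIntegral_const, smul_eq_mul, mul_comm]
      _ ≤ ∫ x in Iic (VaR α G), -x ∂(G : Measure ℝ) :=
          setIntegral_mono_on (integrable_const _).integrableOn hneg.integrableOn
            measurableSet_Iic fun x hx => neg_le_neg hx
      _ ≤ ∫ x in Iic 0, -x ∂(G : Measure ℝ) :=
          setIntegral_mono_set hneg.integrableOn
            ((ae_restrict_mem measurableSet_Iic).mono fun x hx => neg_nonneg.2 hx)
            (LE.le.eventuallyLE (Iic_subset_Iic.2 h))
      _ = -∫ x in Iic 0, x ∂(G : Measure ℝ) := integral_neg _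
      _ ≤ |∫ x in Iic 0, x ∂(G : Measure ℝ)| := neg_le_abs _
      _ ≤ _ := le_max_left _ _

/-- The modulus of continuity of the quantile with respect to the tail norm. -/
lemma abs_VaR_sub_le (hα : α ∈ Ioo (0 : ℝ) 1) {b M c : ℝ} (hb : 0 < b) (hM : 0 < M)
    (hgrowth : ∀ y ∈ Icc (-M) M, |y| ≤ |cdf (G : Measure ℝ) (VaR α G + b * y) - α|)
    (hG : Integrable (fun x : ℝ => x) (G : Measure ℝ))
    (hH : Integrable (fun x : ℝ => x) (H : Measure ℝ))
    (hc : tailNorm (G : Measure ℝ).toSignedMeasure ≤ c) :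
    |VaR α G - VaR α H| ≤
      max b ((M + 2 * c) / (min α (1 - α) * M)) * tailNorm (diff G H) := by
  have hN := tailNorm_diff_nonneg G H
  rcases lt_or_ge (tailNorm (diff G H)) M with hNM | hNM
  · exact (abs_VaR_sub_le_of_growth hα hb hgrowth hN hNM (abs_cdf_sub_le_tailNorm G H)).trans
      (mul_le_mul_of_nonneg_right (le_max_left _ _) hN)
  · have hm : 0 < min α (1 - α) := lt_min hα.1 (by linarith [hα.2])
    rw [tailNorm_toSignedMeasure, max_le_iff, max_le_iff] at hc
    obtain ⟨hc1, hc2, hc3⟩ := hc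
    have h1 := abs_setIntegral_Iic_sub_le_tailNorm hG hH
    have h2 := abs_setIntegral_Ici_sub_le_tailNorm hG hH
    have hGv : |VaR α G| * min α (1 - α) ≤ c := (abs_VaR_mul_le hα hG).trans (max_le hc2 hc3)
    have hHv : |VaR α H| * min α (1 - α) ≤ c + tailNorm (diff G H) := by
      refine (abs_VaR_mul_le hα hH).trans (max_le ?_ ?_)
      · rw [abs_le] at *
        constructor <;> linarith
      · rw [abs_le] at *
        constructor <;> linarith
    calc |VaR α G - VaR α H| ≤ |VaR α G| + |VaR α H| := abs_sub _ _
      _ ≤ (2 * c + tailNorm (diff G H)) / min α (1 - α) := by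
        rw [le_div_iff₀ hm]
        linarith
      _ ≤ (M + 2 * c) / (min α (1 - α) * M) * tailNorm (diff G H) := by
        rw [div_mul_eq_mul_div, div_le_div_iff₀ hm (mul_pos hm hM)]
        -- This is where the case `M ≤ N` enters.
        have : c * M ≤ c * tailNorm (diff G H) := by gcongr
        nlinarith
      _ ≤ _ := mul_le_mul_of_nonneg_right (le_max_right _ _) hN

end ValueAtRisk

end RiskBandit

namespace RiskBandit

/-! ### A maximal inequality over nested sets and a DKW inequality. -/

section NestedSets

variable {S ι : Type*} [MeasurableSpace S]

/-- The events in the product space that are decided by the coordinates lying in `B`, each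
coordinate outside of `B` being hidden. -/
@[reducible]
def hiddenSigmaAlgebra (ι : Type*) (B : Set S) : MeasurableSpace (ι → S) where
  MeasurableSet' A := MeasurableSet A ∧
    ∀ x y : ι → S, (∀ s, x s = y s ∨ (x s ∉ B ∧ y s ∉ B)) → x ∈ A → y ∈ A
  measurableSet_empty := ⟨MeasurableSet.empty, fun _ _ _ h => h⟩
  measurableSet_compl A hA := ⟨hA.1.compl, fun x y h hx hy => hx <| hA.2 y x
    (fun s => (h s).imp Eq.symm And.symm) hy⟩
  measurableSet_iUnion f hf := ⟨MeasurableSet.iUnion fun n => (hf n).1, fun x y h hx => by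
    obtain ⟨n, hn⟩ := mem_iUnion.1 hx
    exact mem_iUnion.2 ⟨n, (hf n).2 x y h hn⟩⟩

/-- The filtration revealing the coordinates lying in larger and larger sets. -/
def hiddenFiltration (ι : Type*) {B : ℕ → Set S} (hB : Monotone B) :
    Filtration ℕ (inferInstance : MeasurableSpace (ι → S)) where
  seq k := hiddenSigmaAlgebra ι (B k)
  mono' _ _ hkl _ hA := ⟨hA.1, fun x y h =>
    hA.2 x y fun s => (h s).imp_right fun h' => ⟨fun hx => h'.1 (hB hkl hx),
      fun hy => h'.2 (hB hkl hy)⟩⟩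
  le' _ _ hA := hA.1

lemma measurable_hiddenSigmaAlgebra {B : Set S} {f : (ι → S) → ℝ} (hf : Measurable f)
    (hinv : ∀ x y : ι → S, (∀ s, x s = y s ∨ (x s ∉ B ∧ y s ∉ B)) → f x = f y) :
    Measurable[hiddenSigmaAlgebra ι B] f :=
  fun T hT => ⟨hf hT, fun x y h hx => by rwa [mem_preimage, ← hinv x y h]⟩

variable (μ : Measure S)

/-- The centred and rescaled indicator of `B`. Along an increasing family of sets this is a
martingale. -/
noncomputable def compensated (B : Set S) (x : S) : ℝ :=
  (B.indicator 1 x - μ.real B) / (1 - μ.real B)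

variable {μ} {B B' : Set S}

lemma compensated_of_mem (hμ : μ.real B < 1) {x : S} (hx : x ∈ B) : compensated μ B x = 1 := by
  rw [compensated, indicator_of_mem hx, Pi.one_apply, div_self (by linarith)]

lemma compensated_of_notMem {x : S} (hx : x ∉ B) :
    compensated μ B x = -μ.real B / (1 - μ.real B) := by
  rw [compensated, indicator_of_notMem hx, zero_sub]

lemma measurable_compensated (hB : MeasurableSet B) : Measurable (compensated μ B) :=
  ((measurable_one.indicator hB).sub_const _).div_const _

/-- The value off `B` is `-m / (1 - m)` with `m = μ B`, which is at least `-1` exactly when `m ≤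
1/2`. -/
lemma compensated_mem_Icc (hμ : μ.real B ≤ 1 / 2) (x : S) :
    compensated μ B x ∈ Icc (-1 : ℝ) 1 := by
  have h0 : 0 ≤ μ.real B := measureReal_nonneg
  by_cases hx : x ∈ B
  · rw [compensated_of_mem (by linarith) hx]
    norm_num
  · rw [compensated_of_notMem hx, mem_Icc, le_div_iff₀ (by linarith), div_le_iff₀ (by linarith)]
    constructor <;> linarith

lemma abs_compensated_le (hμ : μ.real B ≤ 1 / 2) (x : S) : |compensated μ B x| ≤ 1 :=
  abs_le.2 (compensated_mem_Icc hμ x)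

section Sums

variable [Fintype ι]

lemma measurable_exp_sum_compensated (hB : MeasurableSet B) (l : ℝ) :
    Measurable fun x : ι → S => Real.exp (l * ∑ s, compensated μ B (x s)) :=
  ((Finset.measurable_sum _ fun s _ =>
    (measurable_compensated hB).comp (measurable_pi_apply s)).const_mul l).exp

lemma abs_sum_compensated_le (hμ : μ.real B ≤ 1 / 2) (x : ι → S) :
    |∑ s, compensated μ B (x s)| ≤ Fintype.card ι := by
  refine (Finset.abs_sum_le_sum_abs _ _).trans ?_
  refine (Finset.sum_le_sum fun s _ => abs_compensated_le hμ (x s)).trans ?_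
  simp

lemma exp_sum_compensated_le (hμ : μ.real B ≤ 1 / 2) (l : ℝ) (x : ι → S) :
    Real.exp (l * ∑ s, compensated μ B (x s)) ≤ Real.exp (|l| * Fintype.card ι) := by
  rw [Real.exp_le_exp]
  refine (le_abs_self _).trans ?_
  rw [abs_mul]
  exact mul_le_mul_of_nonneg_left (abs_sum_compensated_le hμ x) (abs_nonneg l)

lemma abs_sum_indicator_sub_le (hμ : μ.real B ≤ 1 / 2) (x : ι → S) :
    |∑ s, (B.indicator 1 (x s) - μ.real B)| ≤ |∑ s, compensated μ B (x s)| := by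
  have h0 : 0 ≤ μ.real B := measureReal_nonneg
  have h : ∑ s, (B.indicator 1 (x s) - μ.real B) =
      (1 - μ.real B) * ∑ s, compensated μ B (x s) := by
    rw [Finset.mul_sum]
    refine Finset.sum_congr rfl fun s _ => ?_
    rw [compensated, mul_div_cancel₀ _ (by linarith)]
  rw [h, abs_mul, abs_of_nonneg (by linarith)]
  exact mul_le_of_le_one_left (abs_nonneg _) (by linarith)

end Sums

variable [IsProbabilityMeasure μ]

lemma integral_compensated (hB : MeasurableSet B) : ∫ x, compensated μ B x ∂μ = 0 := by
  have hint : Integrable (B.indicator (1 : S → ℝ)) μ :=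
    (integrable_const (1 : ℝ)).indicator hB
  simp only [compensated]
  rw [integral_div, integral_sub hint (integrable_const _), integral_indicator_one hB]
  simp

lemma integrable_compensated (hB : MeasurableSet B) (hμ : μ.real B ≤ 1 / 2) :
    Integrable (compensated μ B) μ :=
  Integrable.of_bound (measurable_compensated hB).aestronglyMeasurable 1
    (ae_of_all _ (abs_compensated_le hμ))

variable [Fintype ι]

/-- The martingale property, for the coordinate `s`. -/
lemma integral_mul_compensated_sub (hB : MeasurableSet B) (hB' : MeasurableSet B') (hBB' : B ⊆ B')
    (hμ : μ.real B' ≤ 1 / 2) {W : (ι → S) → ℝ} (hW : Measurable W)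
    (hinv : ∀ x y : ι → S, (∀ s, x s = y s ∨ (x s ∉ B ∧ y s ∉ B)) → W x = W y) (s : ι) :
    ∫ x, W x * (compensated μ B' (x s) - compensated μ B (x s))
      ∂(Measure.pi fun _ : ι => μ) = 0 := by
  classical
  have hμB : μ.real B ≤ 1 / 2 := (measureReal_mono hBB').trans hμ
  obtain ⟨p, hp⟩ : ∃ p, p ∉ B := by
    by_contra! h
    rw [eq_univ_of_forall h, probReal_univ] at hμB
    norm_num at hμB
  let D : S → ℝ := fun z => compensated μ B' z - compensated μ B z
  have hD : Measurable D := (measurable_compensated hB').sub (measurable_compensated hB)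
  let V : (({s}ᶜ : Finset ι) → S) → ℝ := fun z =>
    W fun j => if h : j = s then p else z ⟨j, by simpa using h⟩
  have hV : Measurable V := by
    refine hW.comp (measurable_pi_lambda _ fun j => ?_)
    by_cases h : j = s
    · simp [h]
    · simpa [h] using measurable_pi_apply _
  -- If `x s ∈ B`, both terms of the increment are `1` and it vanishes. Otherwise `W` cannot tell `x
  -- s` from the dummy `p`. So `W` may be replaced by a function independent of coordinate `s`.
  have heq : ∀ x : ι → S, W x * D (x s) = V (fun i => x i) * D (x s) := by
    intro x
    by_cases hx : x s ∈ B
    · have : D (x s) = 0 := by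
        simp only [D]
        rw [compensated_of_mem (by linarith) hx, compensated_of_mem (by linarith) (hBB' hx),
          sub_self]
      simp [this]
    · congr 1
      refine hinv _ _ fun j => ?_
      by_cases h : j = s
      · subst h
        exact Or.inr ⟨hx, by simpa using hp⟩
      · left
        simp [h]
  have hindep : IndepFun (fun x : ι → S => V (fun i => x i)) (fun x => D (x s))
      (Measure.pi fun _ : ι => μ) := by
    have h1 : iIndepFun (fun (i : ι) (x : ι → S) => x i) (Measure.pi fun _ : ι => μ) :=
      iIndepFun_pi (X := fun _ => id) fun _ => aemeasurable_id
    have h2 := h1.indepFun_finset ({s}ᶜ : Finset ι) {s} (by simp) fun i => measurable_pi_apply i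
    exact h2.comp (ψ := fun z : ({s} : Finset ι) → S => D (z ⟨s, by simp⟩)) hV
      (hD.comp (measurable_pi_apply _))
  have hint : ∫ x, D (x s) ∂(Measure.pi fun _ : ι => μ) = 0 := by
    have hmp := measurePreserving_eval (fun _ : ι => μ) s
    rw [← integral_map (f := D) hmp.measurable.aemeasurable hD.aestronglyMeasurable,
      hmp.map_eq]
    rw [integral_sub (integrable_compensated hB' hμ) (integrable_compensated hB hμB),
      integral_compensated hB', integral_compensated hB, sub_zero]
  have hVm : Measurable fun x : ι → S => V (fun i => x i) :=
    hV.comp (measurable_pi_lambda (fun (x : ι → S) (i : ({s}ᶜ : Finset ι)) => x i)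
      fun i => measurable_pi_apply _)
  calc ∫ x, W x * D (x s) ∂(Measure.pi fun _ : ι => μ)
      = ∫ x, V (fun i => x i) * D (x s) ∂(Measure.pi fun _ : ι => μ) := by simp_rw [heq]
    _ = (∫ x, V (fun i => x i) ∂(Measure.pi fun _ : ι => μ)) *
        ∫ x, D (x s) ∂(Measure.pi fun _ : ι => μ) :=
      hindep.integral_fun_mul_eq_mul_integral hVm.aestronglyMeasurable
        (hD.comp (measurable_pi_apply s)).aestronglyMeasurable
    _ = 0 := by rw [hint, mul_zero]

lemma integrable_exp_sum_compensated (hB : MeasurableSet B) (hμ : μ.real B ≤ 1 / 2) (l : ℝ) :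
    Integrable (fun x : ι → S => Real.exp (l * ∑ s, compensated μ B (x s)))
      (Measure.pi fun _ : ι => μ) := by
  refine Integrable.of_bound (measurable_exp_sum_compensated hB l).aestronglyMeasurable
    (Real.exp (|l| * Fintype.card ι)) (ae_of_all _ fun x => ?_)
  rw [Real.norm_of_nonneg (Real.exp_nonneg _)]
  exact exp_sum_compensated_le hμ l x

/-- The tangent line bound `exp (a + d) ≥ exp a * (1 + d)` leaves a linear term in the martingale
increment, whose integral over any event known at time `k` is zero. -/
lemma submartingale_exp_sum_compensated {B : ℕ → Set S} (hB : Monotone B)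
    (hBm : ∀ k, MeasurableSet (B k)) (hμ : ∀ k, μ.real (B k) ≤ 1 / 2) (l : ℝ) :
    Submartingale (fun k (x : ι → S) => Real.exp (l * ∑ s, compensated μ (B k) (x s)))
      (hiddenFiltration ι hB) (Measure.pi fun _ : ι => μ) := by
  have hinv : ∀ k (x y : ι → S), (∀ s, x s = y s ∨ (x s ∉ B k ∧ y s ∉ B k)) →
      Real.exp (l * ∑ s, compensated μ (B k) (x s)) =
        Real.exp (l * ∑ s, compensated μ (B k) (y s)) := by
    intro k x y h
    congr 2
    refine Finset.sum_congr rfl fun s _ => ?_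
    rcases h s with h | h
    · rw [h]
    · rw [compensated_of_notMem h.1, compensated_of_notMem h.2]
  refine submartingale_of_setIntegral_le_succ
    (fun k => (measurable_hiddenSigmaAlgebra (measurable_exp_sum_compensated (hBm k) l)
      (hinv k)).stronglyMeasurable)
    (fun k => integrable_exp_sum_compensated (hBm k) (hμ k) l) fun k A hA => ?_
  set f : (ι → S) → ℝ := fun x => Real.exp (l * ∑ s, compensated μ (B k) (x s)) with hf
  let W : (ι → S) → ℝ := A.indicator f
  have hfm : Measurable f := measurable_exp_sum_compensated (hBm k) l
  have hW : Measurable W := hfm.indicator hA.1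
  have hWinv : ∀ x y : ι → S, (∀ s, x s = y s ∨ (x s ∉ B k ∧ y s ∉ B k)) → W x = W y := by
    intro x y h
    by_cases hx : x ∈ A
    · simp only [W]
      rw [indicator_of_mem hx, indicator_of_mem (hA.2 x y h hx)]
      exact hinv k x y h
    · have hy : y ∉ A := fun hy => hx (hA.2 y x (fun s => (h s).imp Eq.symm And.symm) hy)
      simp only [W]
      rw [indicator_of_notMem hx, indicator_of_notMem hy]
  have hWb : ∀ x, |W x| ≤ Real.exp (|l| * Fintype.card ι) := by
    intro x
    by_cases hx : x ∈ A
    · simp only [W]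
      rw [indicator_of_mem hx, abs_of_nonneg (Real.exp_nonneg _)]
      exact exp_sum_compensated_le (hμ k) l x
    · simp only [W]
      rw [indicator_of_notMem hx, abs_zero]
      exact Real.exp_nonneg _
  have hint : ∀ s ∈ (Finset.univ : Finset ι), Integrable (fun x : ι → S =>
      W x * (compensated μ (B (k + 1)) (x s) - compensated μ (B k) (x s)))
      (Measure.pi fun _ : ι => μ) := by
    intro s _
    refine Integrable.of_bound (hW.mul (((measurable_compensated (hBm _)).comp
      (measurable_pi_apply s)).sub ((measurable_compensated (hBm _)).comp
      (measurable_pi_apply s)))).aestronglyMeasurable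
      (Real.exp (|l| * Fintype.card ι) * 2) (ae_of_all _ fun x => ?_)
    rw [Real.norm_eq_abs, abs_mul]
    refine mul_le_mul (hWb x) ?_ (abs_nonneg _) (Real.exp_nonneg _)
    refine (abs_sub _ _).trans ?_
    linarith [abs_compensated_le (hμ (k + 1)) (x s), abs_compensated_le (hμ k) (x s)]
  have hsum : ∫ x, ∑ s, W x * (compensated μ (B (k + 1)) (x s) - compensated μ (B k) (x s))
      ∂(Measure.pi fun _ : ι => μ) = 0 := by
    rw [integral_finsetSum _ hint]
    exact Finset.sum_eq_zero fun s _ => integral_mul_compensated_sub (hBm k) (hBm (k + 1))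
      (hB (Nat.le_succ k)) (hμ (k + 1)) hW hWinv s
  have hfint := (integrable_exp_sum_compensated (ι := ι) (hBm k) (hμ k) l).indicator hA.1
  have hgint := (integrable_exp_sum_compensated (ι := ι) (hBm (k + 1)) (hμ (k + 1)) l).indicator
    hA.1
  rw [← integral_indicator hA.1, ← integral_indicator hA.1]
  calc ∫ x, W x ∂(Measure.pi fun _ : ι => μ)
      = ∫ x, (W x + l * ∑ s, W x *
          (compensated μ (B (k + 1)) (x s) - compensated μ (B k) (x s)))
          ∂(Measure.pi fun _ : ι => μ) := by
        rw [integral_add hfint ((integrable_finsetSum _ hint).const_mul l),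
          integral_const_mul, hsum, mul_zero, add_zero]
    _ ≤ _ := by
        refine integral_mono (hfint.add ((integrable_finsetSum _ hint).const_mul l)) hgint
          fun x => ?_
        by_cases hx : x ∈ A
        · simp only [W]
          rw [indicator_of_mem hx, indicator_of_mem hx, ← Finset.mul_sum, Finset.sum_sub_distrib]
          have h1 : Real.exp (l * ∑ s, compensated μ (B (k + 1)) (x s)) = f x *
              Real.exp (l * (∑ s, compensated μ (B (k + 1)) (x s) -
                ∑ s, compensated μ (B k) (x s))) := by
            rw [hf, ← Real.exp_add]
            congr 1
            ring
          rw [h1]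
          have h2 := Real.add_one_le_exp (l * (∑ s, compensated μ (B (k + 1)) (x s) -
                ∑ s, compensated μ (B k) (x s)))
          have h3 := mul_le_mul_of_nonneg_left h2 (Real.exp_nonneg _ : 0 ≤ f x)
          linarith
        · simp only [W]
          rw [indicator_of_notMem hx, indicator_of_notMem hx]
          simp

lemma integral_exp_sum_compensated_le (hB : MeasurableSet B) (hμ : μ.real B ≤ 1 / 2) (l : ℝ) :
    ∫ x : ι → S, Real.exp (l * ∑ s, compensated μ B (x s)) ∂(Measure.pi fun _ : ι => μ)
      ≤ Real.exp (Fintype.card ι * l ^ 2 / 2) := by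
  have h1 : iIndepFun (fun (s : ι) (x : ι → S) => compensated μ B (x s))
      (Measure.pi fun _ : ι => μ) :=
    iIndepFun_pi (X := fun _ => compensated μ B) fun _ => (measurable_compensated hB).aemeasurable
  have h2 : ∀ s : ι, HasSubgaussianMGF (fun x : ι → S => compensated μ B (x s)) 1
      (Measure.pi fun _ : ι => μ) := by
    intro s
    have hmp := measurePreserving_eval (fun _ : ι => μ) s
    have h := hasSubgaussianMGF_of_mem_Icc_of_integral_eq_zero
      (X := fun x : ι → S => compensated μ B (x s)) (a := -1) (b := 1)
      (μ := Measure.pi fun _ : ι => μ)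
      ((measurable_compensated hB).comp (measurable_pi_apply s)).aemeasurable
      (ae_of_all _ fun x => compensated_mem_Icc hμ (x s))
      (by
        rw [← integral_compensated (μ := μ) hB, ← hmp.map_eq, integral_map
          hmp.measurable.aemeasurable (measurable_compensated hB).aestronglyMeasurable]
        simp [hmp.map_eq, Function.eval])
    have hc : (‖(1 : ℝ) - -1‖₊ / 2) ^ 2 = 1 := by
      ext
      norm_num
    rwa [hc] at h
  have h3 := (HasSubgaussianMGF.sum_of_iIndepFun h1 (s := Finset.univ) fun s _ => h2 s).mgf_le l
  simpa [mgf] using h3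

/-- A maximal inequality for the empirical process over an increasing sequence of sets. -/
lemma measure_exists_le_mul_sum_compensated {B : ℕ → Set S} (hB : Monotone B)
    (hBm : ∀ k, MeasurableSet (B k)) (hμ : ∀ k, μ.real (B k) ≤ 1 / 2) (l v : ℝ) (n : ℕ) :
    (Measure.pi fun _ : ι => μ).real
      {x | ∃ k ≤ n, v ≤ l * ∑ s, compensated μ (B k) (x s)}
      ≤ Real.exp (Fintype.card ι * l ^ 2 / 2 - v) := by
  obtain ⟨c, hc⟩ : ∃ c : ℝ≥0, (c : ℝ) = Real.exp v := ⟨⟨_, Real.exp_nonneg v⟩, rfl⟩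
  have hmax := maximal_ineq (submartingale_exp_sum_compensated (ι := ι) hB hBm hμ l)
    (fun k x => Real.exp_nonneg _) (ε := c) n
  have hset : {x : ι → S | ∃ k ≤ n, v ≤ l * ∑ s, compensated μ (B k) (x s)} =
      {x | (c : ℝ) ≤
        (Finset.range (n + 1)).sup' Finset.nonempty_range_add_one
          fun k => Real.exp (l * ∑ s, compensated μ (B k) (x s))} := by
    ext x
    simp [Finset.le_sup'_iff, hc]
  rw [← hset] at hmax
  have h2 : ENNReal.ofReal (Real.exp v) * (Measure.pi fun _ : ι => μ)
      {x | ∃ k ≤ n, v ≤ l * ∑ s, compensated μ (B k) (x s)} ≤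
      ENNReal.ofReal (Real.exp (Fintype.card ι * l ^ 2 / 2)) := by
    refine le_trans (le_of_eq ?_) (hmax.trans (ENNReal.ofReal_le_ofReal ?_))
    · congr 1
      rw [← hc, ENNReal.ofReal_coe_nnreal]
    · exact (setIntegral_le_integral (integrable_exp_sum_compensated (hBm n) (hμ n) l)
        (ae_of_all _ fun x => Real.exp_nonneg _)).trans
        (integral_exp_sum_compensated_le (hBm n) (hμ n) l)
  have h3 := ENNReal.toReal_mono ENNReal.ofReal_ne_top h2
  rw [ENNReal.toReal_mul, ENNReal.toReal_ofReal (Real.exp_nonneg _),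
    ENNReal.toReal_ofReal (Real.exp_nonneg _)] at h3
  rw [Real.exp_sub, le_div_iff₀ (Real.exp_pos v), mul_comm]
  exact h3

variable [Nonempty ι]

lemma measure_exists_le_abs_sum_indicator_sub {B : ℕ → Set S} (hB : Monotone B)
    (hBm : ∀ k, MeasurableSet (B k)) (hμ : ∀ k, μ.real (B k) ≤ 1 / 2) (u : ℝ) (hu : 0 ≤ u) (n : ℕ) :
    (Measure.pi fun _ : ι => μ).real
      {x | ∃ k ≤ n, u ≤ |∑ s, ((B k).indicator 1 (x s) - μ.real (B k))|}
      ≤ 2 * Real.exp (-u ^ 2 / (2 * Fintype.card ι)) := by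
  have ht : (0 : ℝ) < Fintype.card ι := Nat.cast_pos.2 Fintype.card_pos
  set t : ℝ := (Fintype.card ι : ℝ)
  -- The slopes `±u / t` minimise the exponent `t * l ^ 2 / 2 - |l| * u`.
  have h1 := measure_exists_le_mul_sum_compensated (ι := ι) hB hBm hμ (u / t) (u ^ 2 / t) n
  have h2 := measure_exists_le_mul_sum_compensated (ι := ι) hB hBm hμ (-(u / t)) (u ^ 2 / t) n
  have he1 : t * (u / t) ^ 2 / 2 - u ^ 2 / t = -u ^ 2 / (2 * t) := by
    field_simp
    ring
  have he2 : t * (-(u / t)) ^ 2 / 2 - u ^ 2 / t = -u ^ 2 / (2 * t) := by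
    field_simp
    ring
  rw [he1] at h1
  rw [he2] at h2
  have hsub : {x : ι → S | ∃ k ≤ n, u ≤ |∑ s, ((B k).indicator 1 (x s) - μ.real (B k))|} ⊆
      {x | ∃ k ≤ n, u ^ 2 / t ≤ u / t * ∑ s, compensated μ (B k) (x s)} ∪
      {x | ∃ k ≤ n, u ^ 2 / t ≤ -(u / t) * ∑ s, compensated μ (B k) (x s)} := by
    rintro x ⟨k, hk, hx⟩
    have hut : 0 ≤ u / t := by positivity
    have hsq : u ^ 2 / t = u / t * u := by ring
    rcases le_abs.1 (hx.trans (abs_sum_indicator_sub_le (hμ k) x)) with h | h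
    · exact Or.inl ⟨k, hk, by rw [hsq]; exact mul_le_mul_of_nonneg_left h hut⟩
    · refine Or.inr ⟨k, hk, ?_⟩
      rw [hsq, neg_mul, ← mul_neg]
      exact mul_le_mul_of_nonneg_left h hut
  calc _ ≤ _ := measureReal_mono hsub
    _ ≤ _ := measureReal_union_le _ _
    _ ≤ _ := by linarith

variable {T : Type*} [LinearOrder T]

lemma measure_exists_mem_finset_le_abs_sum_indicator_sub {B : T → Set S} (hB : Monotone B)
    (hBm : ∀ q, MeasurableSet (B q)) (u : ℝ) (hu : 0 ≤ u) (Q : Finset T)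
    (hμ : ∀ q ∈ Q, μ.real (B q) ≤ 1 / 2) :
    (Measure.pi fun _ : ι => μ).real
      {x | ∃ q ∈ Q, u ≤ |∑ s, ((B q).indicator 1 (x s) - μ.real (B q))|}
      ≤ 2 * Real.exp (-u ^ 2 / (2 * Fintype.card ι)) := by
  rcases Q.eq_empty_or_nonempty with rfl | hQ
  · simpa using Real.exp_nonneg _
  have hcard := hQ.card_pos
  -- Increasing enumeration of `Q`, constant after its last element, so that the sets form a chain
  -- indexed by `ℕ`.
  let e : ℕ → T := fun k => Q.orderEmbOfFin rfl ⟨min k (Q.card - 1), by omega⟩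
  have he : Monotone e := fun k m hkm =>
    (Q.orderEmbOfFin rfl).monotone (Fin.mk_le_mk.2 (min_le_min_right _ hkm))
  have hmem : ∀ k, e k ∈ Q := fun k => Q.orderEmbOfFin_mem rfl _
  refine le_trans (measureReal_mono ?_) (measure_exists_le_abs_sum_indicator_sub (ι := ι)
    (hB.comp he) (fun k => hBm _) (fun k => hμ _ (hmem k)) u hu Q.card)
  rintro x ⟨q, hq, hx⟩
  have hq' : q ∈ range (Q.orderEmbOfFin rfl) := by
    rw [Finset.range_orderEmbOfFin]
    exact hq
  obtain ⟨k, rfl⟩ := hq'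
  refine ⟨k, k.2.le, ?_⟩
  have : e k = Q.orderEmbOfFin rfl k := by
    simp only [e]
    congr 1
    ext
    simp only
    omega
  simpa [this] using hx

lemma measure_exists_le_abs_sum_indicator_sub_of_countable [Countable T] {B : T → Set S}
    (hB : Monotone B) (hBm : ∀ q, MeasurableSet (B q)) (u : ℝ) (hu : 0 ≤ u) :
    (Measure.pi fun _ : ι => μ).real
      {x | ∃ q, μ.real (B q) ≤ 1 / 2 ∧ u ≤ |∑ s, ((B q).indicator 1 (x s) - μ.real (B q))|}
      ≤ 2 * Real.exp (-u ^ 2 / (2 * Fintype.card ι)) := by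
  classical
  let E : Finset T → Set (ι → S) := fun Q => {x | ∃ q ∈ Q.filter fun q => μ.real (B q) ≤ 1 / 2,
    u ≤ |∑ s, ((B q).indicator 1 (x s) - μ.real (B q))|}
  have hE : {x : ι → S | ∃ q, μ.real (B q) ≤ 1 / 2 ∧
      u ≤ |∑ s, ((B q).indicator 1 (x s) - μ.real (B q))|} = ⋃ Q, E Q := by
    ext x
    simp only [mem_ofPred_eq, mem_iUnion, E, Finset.mem_filter]
    exact ⟨fun ⟨q, h1, h2⟩ => ⟨{q}, q, ⟨Finset.mem_singleton_self q, h1⟩, h2⟩,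
      fun ⟨Q, q, h1, h2⟩ => ⟨q, h1.2, h2⟩⟩
  have hmono : Monotone E := fun Q Q' hQ x ⟨q, hq, hx⟩ =>
    ⟨q, Finset.filter_subset_filter _ hQ hq, hx⟩
  rw [hE, measureReal_def, hmono.directed_le.measure_iUnion]
  refine ENNReal.toReal_le_of_le_ofReal (by positivity) (iSup_le fun Q => ?_)
  rw [← ENNReal.ofReal_toReal (measure_ne_top (Measure.pi fun _ : ι => μ) (E Q))]
  exact ENNReal.ofReal_le_ofReal (measure_exists_mem_finset_le_abs_sum_indicator_sub hB hBm u hu _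
    fun q hq => (Finset.mem_filter.1 hq).2)

end NestedSets

/-- A Dvoretzky-Kiefer-Wolfowitz inequality, with a nonoptimal constant. -/
lemma measure_exists_rat_le_abs_sum_indicator_Iic_sub {ι : Type*} [Fintype ι] [Nonempty ι]
    (μ : Measure ℝ) [IsProbabilityMeasure μ] {u : ℝ} (hu : 0 ≤ u) :
    (Measure.pi fun _ : ι => μ).real
      {x | ∃ q : ℚ, u ≤ |∑ s, ((Iic (q : ℝ)).indicator 1 (x s) - μ.real (Iic (q : ℝ)))|}
      ≤ 4 * Real.exp (-u ^ 2 / (2 * Fintype.card ι)) := by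
  have h1 := measure_exists_le_abs_sum_indicator_sub_of_countable (ι := ι) (μ := μ)
    (B := fun q : ℚ => Iic (q : ℝ)) (fun p q hpq => Iic_subset_Iic.2 (by exact_mod_cast hpq))
    (fun q => measurableSet_Iic) u hu
  have : Countable ℚᵒᵈ := inferInstanceAs (Countable ℚ)
  -- Upper half-lines shrink as `q` grows; the dual order makes them an increasing family.
  have h2 := measure_exists_le_abs_sum_indicator_sub_of_countable (ι := ι) (μ := μ)
    (B := fun q : ℚᵒᵈ => Ioi ((OrderDual.ofDual q : ℚ) : ℝ))
    (fun p q hpq => Ioi_subset_Ioi (by exact_mod_cast OrderDual.ofDual_le_ofDual.2 hpq))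
    (fun q => measurableSet_Ioi) u hu
  refine (measureReal_mono ?_).trans ((measureReal_union_le _ _).trans
    ((add_le_add h1 h2).trans (by linarith)))
  rintro x ⟨q, hq⟩
  by_cases hμ : μ.real (Iic (q : ℝ)) ≤ 1 / 2
  · exact Or.inl ⟨q, hμ, hq⟩
  · have hc : μ.real (Ioi (q : ℝ)) = 1 - μ.real (Iic (q : ℝ)) := by
      rw [← compl_Iic, probReal_compl_eq_one_sub measurableSet_Iic]
    refine Or.inr ⟨OrderDual.toDual q, ?_, ?_⟩
    · rw [OrderDual.ofDual_toDual, hc]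
      linarith
    · rw [OrderDual.ofDual_toDual, ← abs_neg, ← Finset.sum_neg_distrib]
      convert hq using 4 with s
      rw [hc, ← compl_Iic, indicator_compl]
      simp

end RiskBandit

namespace RiskBandit

/-! ### Sub-Gaussian variables under Lipschitz maps. -/

section SubGaussian

variable {S : Type*} [MeasurableSpace S] {μ : Measure S}

lemma hasSubgaussianMGF_mono {X : S → ℝ} {c d : ℝ≥0} (hX : HasSubgaussianMGF X c μ)
    (hcd : c ≤ d) : HasSubgaussianMGF X d μ :=
  ⟨hX.integrable_exp_mul, fun l => (hX.mgf_le l).trans (Real.exp_le_exp.2 (by gcongr))⟩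

lemma integrable_cosh_mul_sub {X : S → ℝ} {l : ℝ} (hX : Integrable (fun x => Real.exp (l * X x)) μ)
    (hX' : Integrable (fun x => Real.exp (-l * X x)) μ) :
    Integrable (fun z : S × S => Real.cosh (l * (X z.1 - X z.2))) (μ.prod μ) := by
  refine (((hX.mul_prod hX').add (hX'.mul_prod hX)).div_const 2).congr (ae_of_all _ fun z => ?_)
  simp only [Pi.add_apply]
  rw [Real.cosh_eq, ← Real.exp_add, ← Real.exp_add]
  ring_nf

/-- Symmetrisation: the right side depends only on differences of two independent copies, and `cosh`
is increasing in their absolute value. -/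
lemma mgf_mul_mgf_neg [SFinite μ] {X : S → ℝ} {l : ℝ} (hX : Integrable (fun x => Real.exp (l * X x)) μ)
    (hX' : Integrable (fun x => Real.exp (-l * X x)) μ) :
    mgf X μ l * mgf X μ (-l) = ∫ z : S × S, Real.cosh (l * (X z.1 - X z.2)) ∂(μ.prod μ) := by
  have h : ∀ z : S × S, Real.cosh (l * (X z.1 - X z.2)) =
      (Real.exp (l * X z.1) * Real.exp (-l * X z.2) +
        Real.exp (-l * X z.1) * Real.exp (l * X z.2)) / 2 := by
    intro z
    rw [Real.cosh_eq, ← Real.exp_add, ← Real.exp_add]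
    ring_nf
  simp_rw [h]
  rw [integral_div, integral_add (hX.mul_prod hX') (hX'.mul_prod hX),
    integral_prod_mul (fun x => Real.exp (l * X x)) fun x => Real.exp (-l * X x),
    integral_prod_mul (fun x => Real.exp (-l * X x)) fun x => Real.exp (l * X x), mgf, mgf]
  ring

variable [IsProbabilityMeasure μ]

lemma one_le_mgf_of_integral_eq_zero {X : S → ℝ} (hX : Integrable X μ) (h0 : ∫ x, X x ∂μ = 0)
    {l : ℝ} (hexp : Integrable (fun x => Real.exp (l * X x)) μ) : 1 ≤ mgf X μ l := by
  have h1 : ∫ x, (l * X x + 1) ∂μ = 1 := by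
    rw [integral_add (hX.const_mul l) (integrable_const _), integral_const_mul, h0]
    simp
  rw [← h1]
  exact integral_mono ((hX.const_mul l).add (integrable_const _)) hexp
    fun x => Real.add_one_le_exp _

/-- A centred random variable whose increments are dominated by those of a sub-Gaussian one is
sub-Gaussian. -/
lemma hasSubgaussianMGF_of_abs_sub_le {X Y : S → ℝ} {c : ℝ≥0} (hX : HasSubgaussianMGF X c μ)
    (hY : AEMeasurable Y μ) (h0 : ∫ x, Y x ∂μ = 0) (hYX : ∀ x y, |Y x - Y y| ≤ |X x - X y|) :
    HasSubgaussianMGF Y (2 * c) μ := by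
  obtain ⟨p⟩ : Nonempty S := nonempty_of_isProbabilityMeasure μ
  have hbound : ∀ x, |Y x| ≤ |Y p| + |X p| + |X x| := by
    intro x
    have h1 := hYX x p
    have h2 := abs_sub (X x) (X p)
    have h3 := abs_sub_abs_le_abs_sub (Y x) (Y p)
    linarith
  have hYint : Integrable Y μ := by
    refine ((integrable_const (|Y p| + |X p|)).add hX.integrable.abs).mono'
      hY.aestronglyMeasurable (ae_of_all _ fun x => ?_)
    simpa using hbound x
  have hexp : ∀ l, Integrable (fun x => Real.exp (l * Y x)) μ := by
    intro l
    refine (((hX.integrable_exp_mul l).add (hX.integrable_exp_mul (-l))).const_mul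
      (Real.exp (|l| * (|Y p| + |X p|)))).mono'
      (hY.const_mul l).exp.aestronglyMeasurable (ae_of_all _ fun x => ?_)
    have h1 : l * Y x ≤ |l| * (|Y p| + |X p|) + |l * X x| := by
      calc l * Y x ≤ |l * Y x| := le_abs_self _
        _ = |l| * |Y x| := abs_mul _ _
        _ ≤ |l| * (|Y p| + |X p| + |X x|) :=
          mul_le_mul_of_nonneg_left (hbound x) (abs_nonneg l)
        _ = _ := by rw [abs_mul]; ring
    have h2 : Real.exp |l * X x| ≤ Real.exp (l * X x) + Real.exp (-l * X x) := by
      have h3 := Real.exp_nonneg (l * X x)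
      have h4 := Real.exp_nonneg (-l * X x)
      rcases abs_choice (l * X x) with h | h
      · rw [h]
        linarith
      · rw [h, ← neg_mul]
        linarith
    rw [Real.norm_of_nonneg (Real.exp_nonneg _)]
    calc Real.exp (l * Y x) ≤ Real.exp (|l| * (|Y p| + |X p|) + |l * X x|) :=
        Real.exp_le_exp.2 h1
      _ = Real.exp (|l| * (|Y p| + |X p|)) * Real.exp |l * X x| := Real.exp_add _ _
      _ ≤ _ := mul_le_mul_of_nonneg_left h2 (Real.exp_nonneg _)
  refine ⟨hexp, fun l => ?_⟩
  -- Centring gives `mgf Y μ (-l) ≥ 1`; the two factors of the mgf of `X` cause the doubling of `c`.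
  calc mgf Y μ l ≤ mgf Y μ l * mgf Y μ (-l) :=
        le_mul_of_one_le_right mgf_nonneg (one_le_mgf_of_integral_eq_zero hYint h0 (hexp _))
    _ = ∫ z : S × S, Real.cosh (l * (Y z.1 - Y z.2)) ∂(μ.prod μ) :=
        mgf_mul_mgf_neg (hexp _) (hexp _)
    _ ≤ ∫ z : S × S, Real.cosh (l * (X z.1 - X z.2)) ∂(μ.prod μ) := by
        refine integral_mono (integrable_cosh_mul_sub (hexp _) (hexp _))
          (integrable_cosh_mul_sub (hX.integrable_exp_mul _) (hX.integrable_exp_mul _))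
          fun z => ?_
        rw [Real.cosh_le_cosh, abs_mul, abs_mul]
        exact mul_le_mul_of_nonneg_left (hYX _ _) (abs_nonneg l)
    _ = mgf X μ l * mgf X μ (-l) :=
        (mgf_mul_mgf_neg (hX.integrable_exp_mul _) (hX.integrable_exp_mul _)).symm
    _ ≤ Real.exp (c * l ^ 2 / 2) * Real.exp (c * (-l) ^ 2 / 2) :=
        mul_le_mul (hX.mgf_le l) (hX.mgf_le (-l)) mgf_nonneg (Real.exp_nonneg _)
    _ = Real.exp ((2 * c : ℝ≥0) * l ^ 2 / 2) := by
        rw [← Real.exp_add]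
        push_cast
        ring_nf

/-- A two-sided Hoeffding inequality for averages of independent copies. -/
lemma measure_le_abs_sum_of_subgaussian {ι : Type*} [Fintype ι] {Y : S → ℝ} {c : ℝ≥0}
    (hY : HasSubgaussianMGF Y c μ) {u : ℝ} (hu : 0 ≤ u) :
    (Measure.pi fun _ : ι => μ).real {x | u ≤ |∑ s, Y (x s)|}
      ≤ 2 * Real.exp (-u ^ 2 / (2 * (Fintype.card ι * c))) := by
  have key : ∀ Z : S → ℝ, HasSubgaussianMGF Z c μ →
      (Measure.pi fun _ : ι => μ).real {x | u ≤ ∑ s, Z (x s)}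
        ≤ Real.exp (-u ^ 2 / (2 * (Fintype.card ι * c))) := by
    intro Z hZ
    have h1 : iIndepFun (fun (s : ι) (x : ι → S) => Z (x s)) (Measure.pi fun _ : ι => μ) :=
      iIndepFun_pi (X := fun _ => Z) fun _ => hZ.aemeasurable
    have h2 : ∀ s ∈ (Finset.univ : Finset ι), HasSubgaussianMGF (fun x : ι → S => Z (x s)) c
        (Measure.pi fun _ : ι => μ) := by
      intro s _
      have hmp := measurePreserving_eval (fun _ : ι => μ) s
      exact HasSubgaussianMGF.of_map (Y := Function.eval s) hmp.measurable.aemeasurable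
        (by rwa [hmp.map_eq])
    simpa using HasSubgaussianMGF.measure_sum_ge_le_of_iIndepFun h1 h2 hu
  have hsub : {x : ι → S | u ≤ |∑ s, Y (x s)|} ⊆
      {x | u ≤ ∑ s, Y (x s)} ∪ {x | u ≤ ∑ s, (-Y) (x s)} := by
    intro x hx
    rcases le_abs.1 (show u ≤ |∑ s, Y (x s)| from hx) with h | h
    · exact Or.inl h
    · refine Or.inr ?_
      change u ≤ ∑ s, -Y (x s)
      rwa [Finset.sum_neg_distrib]
  refine (measureReal_mono hsub).trans ((measureReal_union_le _ _).trans ?_)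
  linarith [key Y hY, key (-Y) hY.neg]

end SubGaussian

/-! ### Concentration of empirical distributions. -/

section Empirical

variable {t : ℕ} [NeZero t]

lemma integrable_empirical (x : Fin t → ℝ) (f : ℝ → ℝ) :
    Integrable f (empirical x : Measure ℝ) := by
  change Integrable f ((t : ℝ≥0∞)⁻¹ • ∑ s, Measure.dirac (x s))
  refine Integrable.smul_measure ?_ (ENNReal.inv_ne_top.2 (Nat.cast_ne_zero.2 (NeZero.ne t)))
  exact integrable_finsetSum_measure.2 fun s _ => integrable_dirac (by simp)

lemma integral_empirical (x : Fin t → ℝ) (f : ℝ → ℝ) :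
    ∫ y, f y ∂(empirical x : Measure ℝ) = (∑ s, f (x s)) / t := by
  change ∫ y, f y ∂((t : ℝ≥0∞)⁻¹ • ∑ s, Measure.dirac (x s)) = _
  rw [integral_smul_measure, integral_finsetSum_measure fun s _ => integrable_dirac (by simp)]
  simp [div_eq_inv_mul]

lemma mul_integral_empirical_sub (x : Fin t → ℝ) (f : ℝ → ℝ) (m : ℝ) :
    t * |∫ y, f y ∂(empirical x : Measure ℝ) - m| = |∑ s, (f (x s) - m)| := by
  have ht : (0 : ℝ) < t := Nat.cast_pos.2 (NeZero.pos t)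
  rw [integral_empirical, ← abs_of_pos ht, ← abs_mul, abs_of_pos ht, mul_sub,
    mul_div_cancel₀ _ ht.ne', Finset.sum_sub_distrib]
  simp

end Empirical

lemma IsSubGaussian.integrable_id {F : ProbabilityMeasure ℝ} (hF : IsSubGaussian F) :
    Integrable (fun x : ℝ => x) (F : Measure ℝ) := by
  obtain ⟨c, hc⟩ := hF
  refine (hc.integrable.add (integrable_const (∫ y, y ∂(F : Measure ℝ)))).congr
    (ae_of_all _ fun x => ?_)
  simp

/-- A 1-Lipschitz function of a sub-Gaussian random variable is sub-Gaussian once centred. -/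
lemma IsSubGaussian.exists_hasSubgaussianMGF_lipschitz {F : ProbabilityMeasure ℝ}
    (hF : IsSubGaussian F) :
    ∃ c : ℝ≥0, 0 < c ∧ ∀ f : ℝ → ℝ, Measurable f → (∀ x y, |f x - f y| ≤ |x - y|) →
      HasSubgaussianMGF (fun x => f x - ∫ y, f y ∂(F : Measure ℝ)) c (F : Measure ℝ) := by
  have hid := hF.integrable_id
  obtain ⟨c, hc⟩ := hF
  -- The extra `1` keeps the constant positive for a point mass, where `c` may be `0`.
  refine ⟨2 * c + 1, by positivity, fun f hf hlip => ?_⟩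
  have hfint : Integrable f (F : Measure ℝ) := by
    refine ((integrable_const |f 0|).add hid.abs).mono' hf.aestronglyMeasurable
      (ae_of_all _ fun x => ?_)
    have h1 := hlip x 0
    have h2 := abs_sub_abs_le_abs_sub (f x) (f 0)
    rw [sub_zero] at h1
    simp only [Real.norm_eq_abs, Pi.add_apply]
    linarith
  refine hasSubgaussianMGF_mono (hasSubgaussianMGF_of_abs_sub_le hc
    (hf.sub_const _).aemeasurable ?_ fun x y => by simpa using hlip x y) le_self_add
  rw [integral_sub hfint (integrable_const _)]
  simp

/-- The identity vanishes at the cut `0`, so cutting there creates no jump. -/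
lemma abs_indicator_Iic_sub_le (x y : ℝ) :
    |(Iic (0 : ℝ)).indicator (fun z => z) x - (Iic (0 : ℝ)).indicator (fun z => z) y|
      ≤ |x - y| := by
  have h : ∀ z : ℝ, (Iic (0 : ℝ)).indicator (fun z => z) z = min z 0 := by
    intro z
    by_cases hz : z ≤ 0
    · rw [indicator_of_mem (mem_Iic.2 hz), min_eq_left hz]
    · rw [indicator_of_notMem (by simpa using hz), min_eq_right (not_le.1 hz).le]
  rw [h, h]
  simpa using abs_min_sub_min_le_max x 0 y 0

lemma abs_indicator_Ici_sub_le (x y : ℝ) :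
    |(Ici (0 : ℝ)).indicator (fun z => z) x - (Ici (0 : ℝ)).indicator (fun z => z) y|
      ≤ |x - y| := by
  have h : ∀ z : ℝ, (Ici (0 : ℝ)).indicator (fun z => z) z = max z 0 := by
    intro z
    by_cases hz : 0 ≤ z
    · rw [indicator_of_mem (mem_Ici.2 hz), max_eq_left hz]
    · rw [indicator_of_notMem (by simpa using hz), max_eq_right (not_le.1 hz).le]
  rw [h, h]
  simpa using abs_max_sub_max_le_max x 0 y 0

/-- The factor in front of a Gaussian tail bound of a probability can be lowered at the expense of
the rate. -/
lemma le_two_mul_exp_of_le {p u : ℝ} (hp : p ≤ 1) (h : p ≤ 8 * Real.exp (-u)) :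
    p ≤ 2 * Real.exp (-(u / 3)) := by
  have h3 : Real.exp (-u) = Real.exp (-(u / 3)) ^ 3 := by
    rw [← Real.exp_nat_mul]
    congr 1
    push_cast
    ring
  have h0 := Real.exp_pos (-(u / 3))
  -- With `v = exp (-u / 3)`: if `v ≤ 1/2` then `8 * v ^ 3 ≤ 2 * v`; otherwise `2 * v ≥ 1 ≥ p`.
  rcases le_total (Real.exp (-(u / 3))) (1 / 2) with hv | hv
  · rw [h3] at h
    nlinarith [mul_nonneg h0.le (mul_nonneg (sub_nonneg.2 hv) h0.le),
      mul_nonneg h0.le (sub_nonneg.2 hv)]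
  · linarith

/-- The empirical distributions of a sub-Gaussian distribution concentrate in the tail norm. -/
lemma IsSubGaussian.exists_tailNorm_concentration {F : ProbabilityMeasure ℝ}
    (hF : IsSubGaussian F) :
    ∃ a : ℝ, 0 < a ∧ ∀ (t : ℕ) [NeZero t] (x : ℝ), 0 < x →
      (Measure.pi fun _ : Fin t => (F : Measure ℝ)).real
        {y | x ≤ tailNorm (diff (empirical y) F)} ≤ 2 * Real.exp (-a * t * x ^ 2) := by
  have hid := hF.integrable_id
  obtain ⟨c, hc0, hc⟩ := hF.exists_hasSubgaussianMGF_lipschitz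
  have hc0' : (0 : ℝ) < c := hc0
  -- `1 / 8` is the DKW rate at deviation `x / 2`, and `1 / (2 * c)` the Hoeffding rate at deviation
  -- `x`.
  set κ : ℝ := min (1 / 8) (1 / (2 * c)) with hκ
  have hκ0 : 0 < κ := lt_min (by norm_num) (by positivity)
  refine ⟨κ / 3, by positivity, fun t _ x hx => ?_⟩
  have ht : (0 : ℝ) < t := Nat.cast_pos.2 (NeZero.pos t)
  let f₁ : ℝ → ℝ := (Iic (0 : ℝ)).indicator fun z => z
  let f₂ : ℝ → ℝ := (Ici (0 : ℝ)).indicator fun z => z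
  have h1 := measure_exists_rat_le_abs_sum_indicator_Iic_sub (ι := Fin t) (F : Measure ℝ)
    (u := t * (x / 2)) (by positivity)
  have h2 := measure_le_abs_sum_of_subgaussian (ι := Fin t) (u := t * x)
    (hc f₁ (measurable_id.indicator measurableSet_Iic) abs_indicator_Iic_sub_le) (by positivity)
  have h3 := measure_le_abs_sum_of_subgaussian (ι := Fin t) (u := t * x)
    (hc f₂ (measurable_id.indicator measurableSet_Ici) abs_indicator_Ici_sub_le) (by positivity)
  rw [Fintype.card_fin] at h1 h2 h3
  have he1 : Real.exp (-(t * (x / 2)) ^ 2 / (2 * t)) ≤ Real.exp (-(κ * t * x ^ 2)) := by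
    rw [Real.exp_le_exp]
    have : -(t * (x / 2)) ^ 2 / (2 * t) = -(1 / 8 * t * x ^ 2) := by
      field_simp
      ring
    rw [this, neg_le_neg_iff]
    gcongr
    exact min_le_left _ _
  have he2 : Real.exp (-(t * x) ^ 2 / (2 * (t * c))) ≤ Real.exp (-(κ * t * x ^ 2)) := by
    rw [Real.exp_le_exp]
    have : -(t * x) ^ 2 / (2 * (t * c)) = -(1 / (2 * c) * t * x ^ 2) := by
      field_simp
    rw [this, neg_le_neg_iff]
    gcongr
    exact min_le_right _ _
  have hsub : {y : Fin t → ℝ | x ≤ tailNorm (diff (empirical y) F)} ⊆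
      {y | ∃ q : ℚ, t * (x / 2) ≤ |∑ s, ((Iic (q : ℝ)).indicator 1 (y s) -
        (F : Measure ℝ).real (Iic (q : ℝ)))|} ∪
      ({y | t * x ≤ |∑ s, (f₁ (y s) - ∫ z, f₁ z ∂(F : Measure ℝ))|} ∪
      {y | t * x ≤ |∑ s, (f₂ (y s) - ∫ z, f₂ z ∂(F : Measure ℝ))|}) := by
    intro y hy
    rcases exists_rat_or_of_le_tailNorm (integrable_empirical y _) hid hx hy with
      ⟨q, hq⟩ | h | h
    · refine Or.inl ⟨q, ?_⟩
      rw [cdf_eq_real, cdf_eq_real, ← integral_indicator_one measurableSet_Iic] at hq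
      rw [← mul_integral_empirical_sub]
      exact mul_le_mul_of_nonneg_left hq.le ht.le
    · refine Or.inr (Or.inl ?_)
      rw [← integral_indicator measurableSet_Iic, ← integral_indicator measurableSet_Iic] at h
      change t * x ≤ |∑ s, (f₁ (y s) - ∫ z, f₁ z ∂(F : Measure ℝ))|
      rw [← mul_integral_empirical_sub]
      exact mul_le_mul_of_nonneg_left h ht.le
    · refine Or.inr (Or.inr ?_)
      rw [← integral_indicator measurableSet_Ici, ← integral_indicator measurableSet_Ici] at h
      change t * x ≤ |∑ s, (f₂ (y s) - ∫ z, f₂ z ∂(F : Measure ℝ))|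
      rw [← mul_integral_empirical_sub]
      exact mul_le_mul_of_nonneg_left h ht.le
  -- The prefactor is `8 = 4 + 2 + 2`, from DKW and the two moments.
  have hle : (Measure.pi fun _ : Fin t => (F : Measure ℝ)).real
      {y | x ≤ tailNorm (diff (empirical y) F)} ≤ 8 * Real.exp (-(κ * t * x ^ 2)) := by
    refine (measureReal_mono hsub).trans ((measureReal_union_le _ _).trans
      ((add_le_add_right (measureReal_union_le _ _) _).trans ?_))
    linarith
  have := le_two_mul_exp_of_le measureReal_le_one hle
  convert this using 3
  ring

/-! ### Mixtures and the maximal norm. -/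

section Mixture

variable {K : ℕ} {F : Fin K → ProbabilityMeasure ℝ}

lemma integrable_mixture {f : ℝ → ℝ} (hf : ∀ i, Integrable f (F i : Measure ℝ))
    (p : stdSimplex ℝ (Fin K)) : Integrable f (mixture F p : Measure ℝ) := by
  change Integrable f (∑ i, ENNReal.ofReal (p.1 i) • (F i : Measure ℝ))
  exact integrable_finsetSum_measure.2 fun i _ => (hf i).smul_measure ENNReal.ofReal_ne_top

lemma setIntegral_mixture {f : ℝ → ℝ} (hf : ∀ i, Integrable f (F i : Measure ℝ)) {A : Set ℝ}
    (hA : MeasurableSet A) (p : stdSimplex ℝ (Fin K)) :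
    ∫ x in A, f x ∂(mixture F p : Measure ℝ) =
      ∑ i, p.1 i * ∫ x in A, f x ∂(F i : Measure ℝ) := by
  rw [← integral_indicator hA]
  change ∫ x, A.indicator f x ∂(∑ i, ENNReal.ofReal (p.1 i) • (F i : Measure ℝ)) = _
  rw [integral_finsetSum_measure fun i _ =>
    ((hf i).indicator hA).smul_measure ENNReal.ofReal_ne_top]
  refine Finset.sum_congr rfl fun i _ => ?_
  rw [integral_smul_measure, ENNReal.toReal_ofReal (p.2.1 i), integral_indicator hA, smul_eq_mul]

/-- Partial moments are linear in the weights. -/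
lemma continuous_tailNorm_mixture (hF : ∀ i, Integrable (fun x : ℝ => x) (F i : Measure ℝ)) :
    Continuous fun p : stdSimplex ℝ (Fin K) =>
      tailNorm (mixture F p : Measure ℝ).toSignedMeasure := by
  simp_rw [tailNorm_toSignedMeasure, setIntegral_mixture hF measurableSet_Iic,
    setIntegral_mixture hF measurableSet_Ici]
  have h : ∀ i, Continuous fun p : stdSimplex ℝ (Fin K) => p.1 i := fun i =>
    (continuous_apply i).comp continuous_subtype_val
  have hsum : ∀ a : Fin K → ℝ, Continuous fun p : stdSimplex ℝ (Fin K) => ∑ i, p.1 i * a i :=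
    fun a => continuous_finsetSum _ fun i _ => (h i).mul_const _
  exact continuous_const.max ((hsum _).abs.max (hsum _).abs)

lemma exists_isGreatest_tailNorm (hK : 0 < K)
    (hF : ∀ i, Integrable (fun x : ℝ => x) (F i : Measure ℝ)) :
    ∃ c, IsGreatest ((fun G : ProbabilityMeasure ℝ =>
      tailNorm (G : Measure ℝ).toSignedMeasure) '' mixtures F) c := by
  have : Nonempty (Fin K) := ⟨⟨0, hK⟩⟩
  rw [show mixtures F = range (mixture F) from rfl, ← range_comp]
  have hcomp : CompactSpace (stdSimplex ℝ (Fin K)) :=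
    isCompact_iff_compactSpace.1 (isCompact_stdSimplex ℝ (Fin K))
  exact (isCompact_range (continuous_tailNorm_mixture hF)).exists_isGreatest (range_nonempty _)

end Mixture

/-- The joint law of finitely many rewards of one arm. -/
lemma IsRewardArray.map_fin {K : ℕ} {Ω : Type u} [MeasurableSpace Ω]
    {F : Fin K → ProbabilityMeasure ℝ} {P : Measure Ω} [IsProbabilityMeasure P]
    {X : Fin K → ℕ → Ω → ℝ} (hX : IsRewardArray F P X) (i : Fin K) (t : ℕ) :
    P.map (fun ω (s : Fin t) => X i s ω) = Measure.pi fun _ => (F i : Measure ℝ) := by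
  have h1 : iIndepFun (fun s : Fin t => X i s) P :=
    hX.indep.precomp (g := fun s : Fin t => (i, (s : ℕ))) fun a b hab => by
      simpa [Fin.ext_iff] using hab
  have h2 := h1.map_fun_eq_pi_map fun s : Fin t => (hX.measurable i s).aemeasurable
  rw [h2]
  simp_rw [hX.law]

end RiskBandit

/-! ### Strong stability of the quantile. -/

theorem mainTheorem11 {K : ℕ} (hK : 0 < K) (F : Fin K → ProbabilityMeasure ℝ)
    (α : ℝ) (hα : α ∈ Ioo (0 : ℝ) 1)
    (hsub : ∀ i, RiskBandit.IsSubGaussian (F i))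
    (bα Mα : ℝ) (hgrowth : RiskBandit.QuantileGrowth RiskBandit.tailNorm F α bα Mα) :
    ∃ c : ℝ,
      IsGreatest ((fun G : ProbabilityMeasure ℝ =>
        RiskBandit.tailNorm (G : Measure ℝ).toSignedMeasure) '' RiskBandit.mixtures F) c ∧
      RiskBandit.StronglyStableWith.{u} RiskBandit.tailNorm F (RiskBandit.VaR α)
        (max bα ((Mα + 2 * c) / (min α (1 - α) * Mα))) 1 := by
  have hid : ∀ i, Integrable (fun x : ℝ => x) (F i : Measure ℝ) := fun i => (hsub i).integrable_id
  obtain ⟨c, hc⟩ := RiskBandit.exists_isGreatest_tailNorm hK hid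
  refine ⟨c, hc, lt_max_of_lt_left hgrowth.b_pos, le_rfl, ?_, ?_⟩
  · intro G hG H hH
    have hGint : Integrable (fun x : ℝ => x) (G : Measure ℝ) := by
      obtain ⟨p, rfl⟩ := hG
      exact RiskBandit.integrable_mixture hid p
    have hHint : Integrable (fun x : ℝ => x) (H : Measure ℝ) := by
      rcases hH with ⟨p, rfl⟩ | ⟨t, _, x, rfl⟩
      · exact RiskBandit.integrable_mixture hid p
      · exact RiskBandit.integrable_empirical x _
    refine (RiskBandit.abs_VaR_sub_le hα hgrowth.b_pos hgrowth.M_pos (hgrowth.growth G hG)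
      hGint hHint (hc.2 ⟨G, hG, rfl⟩)).trans ?_
    -- For `q = 1` the modulus allows `2 * b * N`; the bound obtained is `b * N`.
    rw [Real.rpow_one]
    exact mul_le_mul_of_nonneg_left (le_add_of_nonneg_left (RiskBandit.tailNorm_diff_nonneg G H))
      (hgrowth.b_pos.le.trans (le_max_left _ _))
  · choose a ha0 ha using fun i => (hsub i).exists_tailNorm_concentration
    have hne : (Finset.univ : Finset (Fin K)).Nonempty := ⟨⟨0, hK⟩, Finset.mem_univ _⟩
    refine ⟨Finset.univ.inf' hne a, (Finset.lt_inf'_iff hne).2 fun i _ => ha0 i, ?_⟩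
    intro Ω _ P _ X hX i t _ x hx
    have hmeas : Measurable fun ω (s : Fin t) => X i s ω :=
      measurable_pi_lambda _ fun s => hX.measurable i s
    -- Passing to the joint law by `Measure.le_map_apply` requires no measurability of the norm
    -- event.
    calc P.real {ω | x ≤ RiskBandit.tailNorm
          (RiskBandit.diff (RiskBandit.empirical fun s : Fin t => X i s ω) (F i))}
        ≤ (P.map fun ω (s : Fin t) => X i s ω).real
          {y | x ≤ RiskBandit.tailNorm (RiskBandit.diff (RiskBandit.empirical y) (F i))} :=
          ENNReal.toReal_mono (measure_ne_top _ _)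
            (Measure.le_map_apply hmeas.aemeasurable _)
      _ ≤ 2 * Real.exp (-a i * t * x ^ 2) := by
          rw [hX.map_fin]
          exact ha i t x hx
      _ ≤ 2 * Real.exp (-Finset.univ.inf' hne a * t * x ^ 2) := by
          have := Finset.inf'_le a (Finset.mem_univ i)
          gcongr
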